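/- The Sign Game on a finite simple graph $G$ is played by two players, Player P and Player N; either of them may play first, and the one who plays first is called Player 1, the other Player 2. The players alternate turns; on a turn, a player chooses any vertex that has not been assigned a value and assigns it either $+1$ or $-1$. The game ends when all vertices have been assigned values. The score of an edge is the product of the values of its two endvertices, and the score $s(G)$ of the game is the sum of the scores of all edges. Player P wins if $s(G)>0$, Player N wins if $s(G)<0$, and the game is a draw if $s(G)=0$. We say that a player wins the game on $G$ (under optimal play) if that player has a winning strategy, and that the game on $G$ is a draw (under optimal play) if each player has a strategy that prevents the other player from winning. **Theorem.** Let $n\ge 3$, let $C_n$ be the cycle graph on $n$ vertices, and let $k\in\{0,1,2,3\}$ with $n\equiv k \pmod 4$. Then the result of the Sign Game on $C_n$, under optimal play, is as follows: - if $k=0$, the game is a draw, whichever player plays first; - if $k=1$, Player P wins, whichever player plays first; - if $k=2$, Player 2 wins, whichever of Player P and Player N that is; - if $k=3$, Player N wins, whichever player plays first. -/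

import Mathlib

namespace SignGame

/-- The two players: `P` (positive) and `N` (negative). -/
inductive Player where
  | P
  | N

/-- The opponent of a player. -/
def Player.other : Player → Player
  | .P => .N
  | .N => .P

/-- A position of the Sign Game on the vertex set `V`: every vertex is either unassigned (`none`)
or carries a sign (`some 1` or `some (-1)`, where `ℤˣ = {1, -1}`). -/
abbrev Position (V : Type*) := V → Option ℤˣ

/-- The initial position: no vertex has been assigned a value. -/
def Position.empty (V : Type*) : Position V := fun _ => none

/-- The position reached from `p` by assigning the sign `s` to the vertex `v`. -/
def Position.assign {V : Type*} [DecidableEq V] (p : Position V) (v : V) (s : ℤˣ) : Position V :=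
  Function.update p v (some s)

/-- The score of an edge: the product of the values of its two endvertices. -/
def edgeScore {V : Type*} (a : V → ℤˣ) (e : Sym2 V) : ℤ :=
  Sym2.lift ⟨fun u v => (a u : ℤ) * (a v : ℤ), fun _ _ => mul_comm _ _⟩ e

/-- The score `s(G)` of a finished game in which the vertices have received the values `a`:
the sum of the scores of all edges. -/
def score {V : Type*} [Fintype V] [DecidableEq V] (G : SimpleGraph V) [DecidableRel G.Adj]
    (a : V → ℤˣ) : ℤ :=
  ∑ e ∈ G.edgeFinset, edgeScore a e

/-- `CanForce G X goal turn p`: in the Sign Game on `G`, from the position `p` with `turn` to move,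
player `X` has a strategy such that, whatever the opponent plays, the score of the finished game
satisfies `goal`. On a turn, a player picks any unassigned vertex and assigns it either sign;
then the other player is to move. -/
inductive CanForce {V : Type*} [Fintype V] [DecidableEq V] (G : SimpleGraph V)
    [DecidableRel G.Adj] (X : Player) (goal : ℤ → Prop) : Player → Position V → Prop
  /-- The game is over: all vertices have values. -/
  | finished (turn : Player) (p : Position V) (a : V → ℤˣ) (ha : ∀ v, p v = some (a v))
      (h : goal (score G a)) : CanForce G X goal turn p
  /-- Player `X` is to move: some legal move works. -/
  | ownTurn (turn : Player) (p : Position V) (hturn : turn = X) (v : V) (s : ℤˣ)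
      (hv : p v = none) (h : CanForce G X goal turn.other (p.assign v s)) :
      CanForce G X goal turn p
  /-- The opponent is to move in an unfinished game: `X` copes with every legal move. -/
  | opponentTurn (turn : Player) (p : Position V) (hturn : turn ≠ X) (hp : ∃ v, p v = none)
      (h : ∀ v, p v = none → ∀ s : ℤˣ, CanForce G X goal turn.other (p.assign v s)) :
      CanForce G X goal turn p

/-- The final scores with which a player wins: positive for `P`, negative for `N`. -/
def Player.WinningScore : Player → ℤ → Prop
  | .P, s => 0 < s
  | .N, s => s < 0

/-- Player `X` wins the Sign Game on `G` (under optimal play) when `first` plays first: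
`X` has a winning strategy. -/
def Wins {V : Type*} [Fintype V] [DecidableEq V] (G : SimpleGraph V) [DecidableRel G.Adj]
    (first X : Player) : Prop :=
  CanForce G X X.WinningScore first (Position.empty V)

/-- The Sign Game on `G` is a draw (under optimal play) when `first` plays first:
each player has a strategy with which the opponent does not win. -/
def Draw {V : Type*} [Fintype V] [DecidableEq V] (G : SimpleGraph V) [DecidableRel G.Adj]
    (first : Player) : Prop :=
  ∀ X : Player, CanForce G X (fun s => ¬ X.other.WinningScore s) first (Position.empty V)

end SignGame

/-! Fix a player `X` and let `t` be the sign with which `X` weighs the score. The assigned vertices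
cut the cycle into runs of unassigned ones. A run of length m covers m + 1 edges, and the product e
of their scores, each multiplied by `t`, is already fixed by the two end values. Give the run the
weight e · (-1)^⌈m/2⌉. In a finished game the total weight is `t * score`.

`X` always extends a run: the vertex next to an assigned one receives the sign that makes the new
edge worth +1 to `X`. With suitable choices of the run, total weight minus number of odd runs does
not decrease between the positions kept by the strategy (`canForce_of_hasRuns`). The first move
leaves a single run of length n - 1 with e = t^n, whose weight and parity depend only on `t` and n
mod 4; this gives the four cases. -/

namespace SignGame

/-! ### Runs of unassigned vertices -/

/-- A description of a position on a set of vertices translated by `c`: the set of assigned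
vertices, their values, and for each assigned vertex the length of the run of unassigned vertices
following it. -/
structure RunDecomposition {V : Type*} [AddCommGroup V] [DecidableEq V] (c : V)
    (p : Position V) where
  support : Finset V
  value : V → ℤˣ
  gap : V → ℕ
  eq_ite : ∀ v, p v = if v ∈ support then some (value v) else none
  next_mem : ∀ i ∈ support, i + (gap i + 1) • c ∈ support
  notMem_of_lt : ∀ i ∈ support, ∀ j < gap i, i + (j + 1) • c ∉ support
  cover : ∀ v ∉ support, ∃ i ∈ support, ∃ j < gap i, v = i + (j + 1) • c

namespace RunDecomposition

variable {V : Type*} [AddCommGroup V] [DecidableEq V] {c : V} {p : Position V}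

/-- The run following `i`: its length, and the product of the values at its two ends, twisted by
one factor `t` for each edge. -/
def run (D : RunDecomposition c p) (t : ℤˣ) (i : V) : ℕ × ℤˣ :=
  (D.gap i, t ^ (D.gap i + 1) * (D.value i * D.value (i + (D.gap i + 1) • c)))

/-- The multiset of all runs. -/
def runs (D : RunDecomposition c p) (t : ℤˣ) : Multiset (ℕ × ℤˣ) :=
  D.support.val.map (D.run t)

theorem eq_of_add_eq (D : RunDecomposition c p) {i k : V} (hi : i ∈ D.support)
    (hk : k ∈ D.support) {j l : ℕ} (hj : j < D.gap i) (hl : l < D.gap k)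
    (h : i + (j + 1) • c = k + (l + 1) • c) : i = k ∧ j = l := by
  wlog hjl : j ≤ l generalizing i k j l
  · obtain ⟨h1, h2⟩ := this hk hi hl hj h.symm (by omega)
    exact ⟨h1.symm, h2.symm⟩
  obtain ⟨d, rfl⟩ := Nat.exists_eq_add_of_le hjl
  have h' : i = k + d • c := by
    have : (j + d + 1) • c = d • c + (j + 1) • c := by rw [← add_nsmul]; congr 1; omega
    rw [this, ← add_assoc] at h
    exact add_right_cancel h
  cases d with
  | zero => simpa using h'
  -- Otherwise `i` would be an assigned vertex inside the run following `k`.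
  | succ d => exact absurd (h' ▸ hi) (D.notMem_of_lt k hk d (by omega))

/-- The decomposition after a move into the run following `i`. -/
def split (D : RunDecomposition c p) {i : V} (hi : i ∈ D.support) {m₁ m₂ : ℕ}
    (hm : D.gap i = m₁ + 1 + m₂) (s : ℤˣ) :
    RunDecomposition c (p.assign (i + (m₁ + 1) • c) s) where
  support := insert (i + (m₁ + 1) • c) D.support
  value := Function.update D.value (i + (m₁ + 1) • c) s
  gap := Function.update (Function.update D.gap i m₁) (i + (m₁ + 1) • c) m₂
  eq_ite v := by
    by_cases hv : v = i + (m₁ + 1) • c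
    · subst hv; simp [Position.assign]
    · simp [Position.assign, hv, D.eq_ite]
  next_mem k hk := by
    have hv := D.notMem_of_lt i hi m₁ (by omega)
    by_cases hkv : k = i + (m₁ + 1) • c
    · subst hkv
      have := D.next_mem i hi
      rw [Function.update_self, add_assoc, ← add_nsmul]
      rw [hm] at this
      exact Finset.mem_insert_of_mem (by convert this using 3; omega)
    · have hkS := Finset.mem_of_mem_insert_of_ne hk hkv
      rw [Function.update_of_ne hkv]
      by_cases hki : k = i
      · subst hki; simp
      · rw [Function.update_of_ne hki]
        exact Finset.mem_insert_of_mem (D.next_mem k hkS)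
  notMem_of_lt k hk j hj := by
    have hv := D.notMem_of_lt i hi m₁ (by omega)
    have key : ∀ k ∈ D.support, ∀ j < D.gap k, (k = i → j ≠ m₁) →
        k + (j + 1) • c ∉ insert (i + (m₁ + 1) • c) D.support := by
      intro k hk j hj hne hmem
      rcases Finset.mem_insert.1 hmem with h | h
      · obtain ⟨h1, h2⟩ := D.eq_of_add_eq hk hi hj (by omega) h
        exact hne h1 h2
      · exact D.notMem_of_lt k hk j hj h
    by_cases hkv : k = i + (m₁ + 1) • c
    · subst hkv
      rw [Function.update_self] at hj
      rw [add_assoc, ← add_nsmul]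
      exact key i hi (m₁ + 1 + j) (by omega) (by omega)
    · have hkS := Finset.mem_of_mem_insert_of_ne hk hkv
      rw [Function.update_of_ne hkv] at hj
      by_cases hki : k = i
      · subst hki
        rw [Function.update_self] at hj
        exact key k hi j (by omega) (by omega)
      · rw [Function.update_of_ne hki] at hj
        exact key k hkS j hj (fun h => absurd h hki)
  cover v hv := by
    rw [Finset.mem_insert, not_or] at hv
    have hv₀ := D.notMem_of_lt i hi m₁ (by omega)
    obtain ⟨k, hk, j, hj, rfl⟩ := D.cover v hv.2
    have hkv : k ≠ i + (m₁ + 1) • c := fun h => hv₀ (h ▸ hk)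
    by_cases hki : k = i
    · subst hki
      rcases lt_trichotomy j m₁ with h | h | h
      · refine ⟨k, Finset.mem_insert_of_mem hk, j, ?_, rfl⟩
        rwa [Function.update_of_ne hkv, Function.update_self]
      · exact absurd (by rw [h]) hv.1
      · refine ⟨_, Finset.mem_insert_self _ _, j - m₁ - 1, ?_, ?_⟩
        · rw [Function.update_self]; omega
        · rw [add_assoc, ← add_nsmul]; congr 2; omega
    · refine ⟨k, Finset.mem_insert_of_mem hk, j, ?_, rfl⟩
      rwa [Function.update_of_ne hkv, Function.update_of_ne hki]

theorem runs_eq_cons (D : RunDecomposition c p) {i : V} (hi : i ∈ D.support) (t : ℤˣ) :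
    D.runs t = D.run t i ::ₘ (D.support.erase i).val.map (D.run t) := by
  rw [runs, ← Multiset.map_cons, Finset.erase_val, Multiset.cons_erase hi]

theorem runs_split (D : RunDecomposition c p) {i : V} (hi : i ∈ D.support) {m₁ m₂ : ℕ}
    (hm : D.gap i = m₁ + 1 + m₂) (s t : ℤˣ) :
    (D.split hi hm s).runs t =
      (m₁, t ^ (m₁ + 1) * (D.value i * s)) ::ₘ
      (m₂, t ^ (m₂ + 1) * (s * D.value (i + (D.gap i + 1) • c))) ::ₘ
      (D.support.erase i).val.map (D.run t) := by
  have hv := D.notMem_of_lt i hi m₁ (by omega)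
  have hiv : i ≠ i + (m₁ + 1) • c := fun h => hv (h ▸ hi)
  have hval : ∀ k ∈ D.support, (D.split hi hm s).value k = D.value k := fun k hk =>
    Function.update_of_ne (fun h : k = i + (m₁ + 1) • c => hv (h ▸ hk)) _ _
  have hself : (D.split hi hm s).run t i = (m₁, t ^ (m₁ + 1) * (D.value i * s)) := by
    have hg : (D.split hi hm s).gap i = m₁ := by simp [split, Function.update_of_ne hiv]
    rw [run, hval i hi, hg]
    simp [split]
  have hnew : (D.split hi hm s).run t (i + (m₁ + 1) • c) =
      (m₂, t ^ (m₂ + 1) * (s * D.value (i + (D.gap i + 1) • c))) := by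
    have hg : (D.split hi hm s).gap (i + (m₁ + 1) • c) = m₂ := by simp [split]
    have hs : (D.split hi hm s).value (i + (m₁ + 1) • c) = s := by simp [split]
    have ha : i + (m₁ + 1) • c + (m₂ + 1) • c = i + (D.gap i + 1) • c := by
      rw [add_assoc, ← add_nsmul, hm]; congr 2
    rw [run, hg, hs, ha, hval _ (D.next_mem i hi)]
  have hrest : ∀ k ∈ (D.support.erase i).val, (D.split hi hm s).run t k = D.run t k := by
    intro k hk
    obtain ⟨hki, hkS⟩ := Finset.mem_erase.1 hk
    have hg : (D.split hi hm s).gap k = D.gap k := by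
      have hkv : k ≠ i + (m₁ + 1) • c := fun h => hv (h ▸ hkS)
      simp [split, Function.update_of_ne hki, Function.update_of_ne hkv]
    rw [run, hg, hval k hkS, hval _ (D.next_mem k hkS), run]
  have hS : (D.split hi hm s).support.val =
      (i + (m₁ + 1) • c) ::ₘ i ::ₘ (D.support.erase i).val := by
    rw [Finset.erase_val, Multiset.cons_erase hi]
    exact Finset.insert_val_of_notMem hv
  rw [runs, hS, Multiset.map_cons, Multiset.map_cons, hself, hnew, Multiset.map_congr rfl hrest,
    Multiset.cons_swap]

end RunDecomposition

/-! ### Moves as operations on the multiset of runs -/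

/-- The position `p` has the multiset `M` of runs, with one factor `t` for each edge. -/
def HasRuns {V : Type*} [AddCommGroup V] [DecidableEq V] (c : V) (t : ℤˣ) (p : Position V)
    (M : Multiset (ℕ × ℤˣ)) : Prop :=
  ∃ D : RunDecomposition c p, D.runs t = M

section HasRuns

variable {V : Type*} [AddCommGroup V] [DecidableEq V] {c : V} {t : ℤˣ} {p : Position V}
  {M : Multiset (ℕ × ℤˣ)}

/-- The products multiply because the new value `s` ends both parts and `s * s = 1`. -/
theorem HasRuns.exists_split (h : HasRuns c t p M) {v : V} (hv : p v = none) (s : ℤˣ) :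
    ∃ (m₁ m₂ : ℕ) (d₁ d₂ : ℤˣ) (R : Multiset (ℕ × ℤˣ)), M = (m₁ + 1 + m₂, d₁ * d₂) ::ₘ R ∧
      HasRuns c t (p.assign v s) ((m₁, d₁) ::ₘ (m₂, d₂) ::ₘ R) := by
  obtain ⟨D, rfl⟩ := h
  have hvS : v ∉ D.support := fun h => by simp [D.eq_ite, h] at hv
  obtain ⟨i, hi, m₁, hj, rfl⟩ := D.cover v hvS
  obtain ⟨m₂, hm⟩ := Nat.exists_eq_add_of_le (Nat.succ_le_of_lt hj)
  have hm : D.gap i = m₁ + 1 + m₂ := by omega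
  refine ⟨m₁, m₂, _, _, _, ?_, D.split hi hm s, D.runs_split hi hm s t⟩
  rw [D.runs_eq_cons hi, RunDecomposition.run]
  congr 2
  · rw [hm, show m₁ + 1 + m₂ + 1 = (m₁ + 1) + (m₂ + 1) by omega, pow_add]
    have hs : s * s = 1 := Int.units_mul_self s
    calc _ = t ^ (m₁ + 1) * t ^ (m₂ + 1) * (D.value i * D.value (i + (m₁ + 1 + (m₂ + 1)) • c)) *
          (s * s) := by rw [hs, mul_one]
      _ = _ := by ac_rfl

theorem HasRuns.exists_extend {m : ℕ} {e : ℤˣ} {R : Multiset (ℕ × ℤˣ)}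
    (h : HasRuns c t p ((m + 1, e) ::ₘ R)) :
    ∃ v s, p v = none ∧ HasRuns c t (p.assign v s) ((0, 1) ::ₘ (m, e) ::ₘ R) := by
  obtain ⟨D, hD⟩ := h
  have hmem : (m + 1, e) ∈ D.runs t := by rw [hD]; exact Multiset.mem_cons_self _ _
  obtain ⟨i, hi, hrun⟩ := Multiset.mem_map.1 hmem
  have hi : i ∈ D.support := hi
  have hm : D.gap i = 0 + 1 + m := by
    have : D.gap i = m + 1 := congrArg Prod.fst hrun
    omega
  have he : t ^ (D.gap i + 1) * (D.value i * D.value (i + (D.gap i + 1) • c)) = e :=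
    congrArg Prod.snd hrun
  rw [D.runs_eq_cons hi, hrun, Multiset.cons_inj_right] at hD
  -- This sign gives the new edge the score `t`, hence the twisted score 1, so the rest of the run
  -- keeps the product `e`.
  refine ⟨i + (0 + 1) • c, t * D.value i, ?_, D.split hi hm _, ?_⟩
  · rw [D.eq_ite, if_neg (D.notMem_of_lt i hi 0 (by omega))]
  · rw [D.runs_split, hD, ← he]
    have h1 : t ^ (0 + 1) * (D.value i * (t * D.value i)) = 1 := by
      have h2 := Int.units_mul_self t
      have h3 := Int.units_mul_self (D.value i)
      calc _ = (t * t) * (D.value i * D.value i) := by rw [zero_add, pow_one]; ac_rfl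
        _ = 1 := by rw [h2, h3, one_mul]
    rw [h1]
    congr 3
    rw [hm, show 0 + 1 + m + 1 = m + 1 + 1 by omega, pow_succ t (m + 1)]
    ac_rfl

end HasRuns

/-! ### Weights and their change under moves -/

/-- The contribution of a run to the score that the maximizing player can secure. -/
def runWeight (r : ℕ × ℤˣ) : ℤ := (r.2 : ℤ) * (-1) ^ ((r.1 + 1) / 2)

theorem runWeight_eq_or (r : ℕ × ℤˣ) : runWeight r = 1 ∨ runWeight r = -1 := by
  rcases Int.units_eq_one_or r.2 with h | h <;>
    rcases neg_one_pow_eq_or ℤ ((r.1 + 1) / 2) with h' | h' <;> simp [runWeight, h, h']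

/-- The total weight of a multiset of runs. -/
def totalWeight (M : Multiset (ℕ × ℤˣ)) : ℤ := (M.map runWeight).sum

/-- The number of runs of odd length. -/
def oddRuns (M : Multiset (ℕ × ℤˣ)) : ℕ := (M.map fun r => r.1 % 2).sum

/-- The total length of all runs. -/
def totalLength (M : Multiset (ℕ × ℤˣ)) : ℕ := (M.map Prod.fst).sum

theorem totalWeight_cons (r : ℕ × ℤˣ) (M : Multiset (ℕ × ℤˣ)) :
    totalWeight (r ::ₘ M) = runWeight r + totalWeight M := by simp [totalWeight]

theorem oddRuns_cons (r : ℕ × ℤˣ) (M : Multiset (ℕ × ℤˣ)) :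
    oddRuns (r ::ₘ M) = r.1 % 2 + oddRuns M := by simp [oddRuns]

theorem totalLength_cons (r : ℕ × ℤˣ) (M : Multiset (ℕ × ℤˣ)) :
    totalLength (r ::ₘ M) = r.1 + totalLength M := by simp [totalLength]

theorem runWeight_zero_one : runWeight (0, 1) = 1 := by simp [runWeight]

theorem runWeight_succ_of_odd {m : ℕ} (hm : m % 2 = 1) (e : ℤˣ) :
    runWeight (m + 1, e) = runWeight (m, e) := by
  simp only [runWeight]
  congr 2
  omega

theorem runWeight_succ_of_even {m : ℕ} (hm : m % 2 = 0) (e : ℤˣ) :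
    runWeight (m + 1, e) = -runWeight (m, e) := by
  simp only [runWeight]
  rw [show (m + 1 + 1) / 2 = (m + 1) / 2 + 1 by omega, pow_succ]
  ring

theorem runWeight_split_of_even {m₁ m₂ : ℕ} (h₁ : m₁ % 2 = 0) (h₂ : m₂ % 2 = 0) (d₁ d₂ : ℤˣ) :
    runWeight (m₁ + 1 + m₂, d₁ * d₂) = -(runWeight (m₁, d₁) * runWeight (m₂, d₂)) := by
  simp only [runWeight]
  rw [show (m₁ + 1 + m₂ + 1) / 2 = (m₁ + 1) / 2 + (m₂ + 1) / 2 + 1 by omega, pow_succ, pow_add]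
  push_cast
  ring

theorem runWeight_split_of_odd {m₁ m₂ : ℕ} (h₁ : m₁ % 2 = 1) (d₁ d₂ : ℤˣ) :
    runWeight (m₁ + 1 + m₂, d₁ * d₂) = runWeight (m₁, d₁) * runWeight (m₂, d₂) := by
  simp only [runWeight]
  rw [show (m₁ + 1 + m₂ + 1) / 2 = (m₁ + 1) / 2 + (m₂ + 1) / 2 by omega, pow_add]
  push_cast
  ring

/-- The expression is (1 + w)(1 + w') with both factors nonnegative. It bounds the balance of every
exchange opened by the opponent. -/
theorem add_add_one_add_mul_nonneg (r r' : ℕ × ℤˣ) :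
    0 ≤ 1 + runWeight r + runWeight r' + runWeight r * runWeight r' := by
  rcases runWeight_eq_or r with h | h <;> rcases runWeight_eq_or r' with h' | h' <;> simp [h, h']

theorem Player.other_ne (X : Player) : X.other ≠ X := by cases X <;> simp [Player.other]

theorem Player.other_other (X : Player) : X.other.other = X := by cases X <;> rfl

theorem Player.other_eq_of_ne {Y X : Player} (h : Y ≠ X) : Y.other = X := by
  cases X <;> cases Y <;> simp_all [Player.other]

theorem exists_eq_cons_of_totalLength_pos {M : Multiset (ℕ × ℤˣ)} (h : 0 < totalLength M) :
    ∃ m e R, M = (m + 1, e) ::ₘ R := by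
  by_contra! hM
  refine h.ne' (Multiset.sum_eq_zero fun x hx => ?_)
  obtain ⟨⟨m, e⟩, hr, rfl⟩ := Multiset.mem_map.1 hx
  obtain ⟨R, hR⟩ := Multiset.exists_cons_of_mem hr
  cases m with
  | zero => rfl
  | succ m => exact absurd hR (hM m e R)

/-! ### The extending strategy -/

section Strategy

variable {V : Type*} [AddCommGroup V] [Fintype V] [DecidableEq V] {c : V} {t : ℤˣ}

theorem HasRuns.exists_score_eq {G : SimpleGraph V} [DecidableRel G.Adj]
    (hG : ∀ a, score G a = ∑ i, (a i : ℤ) * (a (i + c) : ℤ)) {p : Position V}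
    {M : Multiset (ℕ × ℤˣ)} (h : HasRuns c t p M) (hM : totalLength M = 0) :
    ∃ a : V → ℤˣ, (∀ v, p v = some (a v)) ∧ (t : ℤ) * score G a = totalWeight M := by
  obtain ⟨D, rfl⟩ := h
  have hgap : ∀ i ∈ D.support, D.gap i = 0 := fun i hi =>
    Multiset.sum_eq_zero_iff.1 hM _
      (Multiset.mem_map_of_mem _ (Multiset.mem_map_of_mem (D.run t) hi))
  have hS : D.support = Finset.univ := by
    refine Finset.eq_univ_iff_forall.2 fun v => by_contra fun hv => ?_
    obtain ⟨i, hi, j, hj, -⟩ := D.cover v hv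
    rw [hgap i hi] at hj
    omega
  refine ⟨D.value, fun v => by simp [D.eq_ite, hS], ?_⟩
  rw [hG, totalWeight, RunDecomposition.runs, hS, Multiset.map_map, Finset.mul_sum]
  refine Finset.sum_congr rfl fun i _ => ?_
  simp [RunDecomposition.run, runWeight, hgap i (hS ▸ Finset.mem_univ i)]

/-- The extending strategy: a player who has to move with no odd run present, or whose opponent
has to move with at most one odd run present, secures the total weight of the runs minus the
number of odd runs. -/
theorem canForce_of_hasRuns {G : SimpleGraph V} [DecidableRel G.Adj]
    (hG : ∀ a, score G a = ∑ i, (a i : ℤ) * (a (i + c) : ℤ)) {X : Player} {goal : ℤ → Prop}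
    {T : ℤ} (hgoal : ∀ z : ℤ, T ≤ t * z → goal z) {p : Position V} {M : Multiset (ℕ × ℤˣ)}
    (h : HasRuns c t p M) {turn : Player} (hodd : oddRuns M ≤ 1)
    (hturn : turn = X → oddRuns M = 0) (hT : T + oddRuns M ≤ totalWeight M) :
    CanForce G X goal turn p := by
  induction hN : totalLength M using Nat.strong_induction_on generalizing p M turn with
  | _ N ih =>
  rcases Nat.eq_zero_or_pos N with rfl | hpos
  · obtain ⟨a, ha, hs⟩ := h.exists_score_eq hG hN
    exact .finished turn p a ha (hgoal _ (by omega))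
  obtain ⟨m, e, R, rfl⟩ := exists_eq_cons_of_totalLength_pos (hN ▸ hpos)
  by_cases hX : turn = X
  · obtain ⟨v, s, hv, h'⟩ := h.exists_extend
    have h0 := hturn hX
    simp only [oddRuns_cons, totalWeight_cons, totalLength_cons] at h0 hT hN
    refine .ownTurn turn p hX v s hv (ih _ ?_ h' ?_ ?_ ?_ rfl)
    · simp only [totalLength_cons]; omega
    · simp only [oddRuns_cons]; omega
    · exact fun hc => absurd (hX ▸ hc) turn.other_ne
    -- An even run becomes odd without changing weight; the new edge, worth 1, pays for the odd run
    -- created.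
    · have := runWeight_succ_of_odd (m := m) (by omega) e
      simp only [oddRuns_cons, totalWeight_cons, runWeight_zero_one]
      omega
  · have hfree : ∃ v, p v = none := by
      obtain ⟨v, s, hv, -⟩ := h.exists_extend
      exact ⟨v, hv⟩
    refine .opponentTurn turn p hX hfree fun v hv s => ?_
    obtain ⟨m₁, m₂, d₁, d₂, R', hR, h'⟩ := h.exists_split hv s
    rw [hR] at hodd hT hN
    generalize p.assign v s = q at h'
    have hX' := Player.other_eq_of_ne hX
    -- The player extends an odd run adjacent to the move of the opponent.
    have reply : ∀ {m₁ m₂ : ℕ} {d₁ d₂ : ℤˣ}, m₁ % 2 = 1 →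
        oddRuns ((m₁ + 1 + m₂, d₁ * d₂) ::ₘ R') ≤ 1 →
        T + oddRuns ((m₁ + 1 + m₂, d₁ * d₂) ::ₘ R') ≤
          totalWeight ((m₁ + 1 + m₂, d₁ * d₂) ::ₘ R') →
        totalLength ((m₁ + 1 + m₂, d₁ * d₂) ::ₘ R') = N →
        HasRuns c t q ((m₁, d₁) ::ₘ (m₂, d₂) ::ₘ R') → CanForce G X goal turn.other q := by
      intro m₁ m₂ d₁ d₂ h₁ hodd hT hN h'
      obtain ⟨k, rfl⟩ : ∃ k, m₁ = k + 1 := ⟨m₁ - 1, by omega⟩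
      obtain ⟨w, s', hw, h''⟩ := h'.exists_extend
      -- With w, w' the weights of `(k, d₁)` and `(m₂, d₂)`, the two moves replace -w w' by 1 + w +
      -- w'. The number of odd runs is unchanged, since `m₁ + 1 + m₂` has the parity of `m₂`.
      have hsplit := runWeight_split_of_odd (m₂ := m₂) h₁ d₁ d₂
      have hsucc := runWeight_succ_of_even (m := k) (by omega) d₁
      have hnonneg := add_add_one_add_mul_nonneg (k, d₁) (m₂, d₂)
      rw [hsucc, neg_mul] at hsplit
      simp only [oddRuns_cons, totalWeight_cons, totalLength_cons] at hodd hT hN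
      refine .ownTurn _ q hX' w s' hw (ih _ ?_ h'' ?_ ?_ ?_ rfl)
      · simp only [totalLength_cons]; omega
      · simp only [oddRuns_cons]; omega
      · exact fun hc => absurd (turn.other_other ▸ hc) hX
      · simp only [oddRuns_cons, totalWeight_cons, runWeight_zero_one]
        omega
    by_cases h₁ : m₁ % 2 = 1
    · exact reply h₁ hodd hT hN h'
    by_cases h₂ : m₂ % 2 = 1
    · rw [show m₁ + 1 + m₂ = m₂ + 1 + m₁ by omega, mul_comm] at hodd hT hN
      exact reply h₂ hodd hT hN (Multiset.cons_swap _ _ _ ▸ h')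
    -- Here the opponent has split the only odd run into two even ones, so no reply is needed to
    -- restore the invariant: the vanished odd run supplies the 1 in (1 + w)(1 + w').
    have hsplit := runWeight_split_of_even (m₁ := m₁) (m₂ := m₂) (by omega) (by omega) d₁ d₂
    have hnonneg := add_add_one_add_mul_nonneg (m₁, d₁) (m₂, d₂)
    simp only [oddRuns_cons, totalWeight_cons, totalLength_cons] at hodd hT hN
    refine ih _ ?_ h' ?_ ?_ ?_ rfl
    · simp only [totalLength_cons]; omega
    · simp only [oddRuns_cons]; omega
    · intro
      simp only [oddRuns_cons]; omega
    · simp only [oddRuns_cons, totalWeight_cons]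
      omega

end Strategy

/-! ### The cycle graph and its opening moves -/

theorem score_cycleGraph {n : ℕ} [NeZero n] (hn : 3 ≤ n) (a : Fin n → ℤˣ) :
    score (SimpleGraph.cycleGraph n) a = ∑ i, (a i : ℤ) * (a (i + 1) : ℤ) := by
  obtain ⟨k, rfl⟩ := Nat.exists_eq_add_of_le' hn
  have himage : (SimpleGraph.cycleGraph (k + 3)).edgeFinset =
      Finset.univ.image fun i : Fin (k + 3) => s(i, i + 1) := by
    ext e
    induction e with | _ u v
    simp only [SimpleGraph.mem_edgeFinset, SimpleGraph.mem_edgeSet, SimpleGraph.cycleGraph_adj,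
      Finset.mem_image, Finset.mem_univ, true_and, Sym2.eq_iff, sub_eq_iff_eq_add]
    constructor
    · rintro (h | h)
      · exact ⟨v, Or.inr ⟨rfl, (add_comm _ _).trans h.symm⟩⟩
      · exact ⟨u, Or.inl ⟨rfl, (add_comm _ _).trans h.symm⟩⟩
    · rintro ⟨i, ⟨rfl, rfl⟩ | ⟨rfl, rfl⟩⟩
      · exact Or.inr (add_comm _ _)
      · exact Or.inl (add_comm _ _)
  -- This makes `i ↦ s(i, i + 1)` injective, so that no edge is counted twice.
  have htwo : (1 + 1 : Fin (k + 3)) ≠ 0 := by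
    simp [Fin.ext_iff, Fin.val_add, Nat.mod_eq_of_lt (show 2 < k + 3 by omega)]
  rw [score, himage, Finset.sum_image]
  · rfl
  · intro i _ j _ hij
    rcases Sym2.eq_iff.1 hij with ⟨h, -⟩ | ⟨h, h'⟩
    · exact h
    · rw [h, add_assoc, add_eq_left] at h'
      exact absurd h' htwo

theorem fin_val_nsmul_one {n : ℕ} [NeZero n] (u : Fin n) : u.val • (1 : Fin n) = u := by
  have h : ∀ m : ℕ, (m • (1 : Fin n)).val = m % n := by
    intro m
    induction m with
    | zero => simp
    | succ m ih => rw [succ_nsmul, Fin.val_add, ih, Fin.val_one', Nat.add_mod m 1 n]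
  exact Fin.ext ((h _).trans (Nat.mod_eq_of_lt u.isLt))

theorem card_nsmul_fin_one (n : ℕ) [NeZero n] : n • (1 : Fin n) = 0 := by
  simpa using card_nsmul_eq_zero (x := (1 : Fin n))

/-- The single run starts and ends at `v`, so its end values cancel. -/
theorem hasRuns_assign_empty {n : ℕ} [NeZero n] (v : Fin n) (s t : ℤˣ) :
    HasRuns 1 t ((Position.empty (Fin n)).assign v s) {(n - 1, t ^ n)} := by
  have hn : n - 1 + 1 = n := Nat.sub_add_cancel (NeZero.pos n)
  refine ⟨⟨{v}, fun _ => s, fun _ => n - 1, ?_, ?_, ?_, ?_⟩, ?_⟩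
  · intro w
    by_cases hw : w = v
    · subst hw; simp [Position.assign]
    · simp [Position.assign, Position.empty, hw]
  · simp [hn, card_nsmul_fin_one]
  · intro i hi j hj h
    rw [Finset.mem_singleton] at hi h
    rw [hi, add_eq_left] at h
    have hj' : j + 1 < n := by omega
    have h2 := fin_val_nsmul_one (⟨j + 1, hj'⟩ : Fin n)
    simp only [h] at h2
    simpa using congrArg Fin.val h2
  · intro w hw
    have hwv : (w - v).val ≠ 0 := by
      rw [Fin.val_ne_zero_iff, sub_ne_zero]
      simpa using hw
    have hlt := (w - v).isLt
    refine ⟨v, Finset.mem_singleton_self v, (w - v).val - 1, by omega, ?_⟩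
    rw [Nat.sub_add_cancel (Nat.pos_of_ne_zero hwv), fin_val_nsmul_one, add_sub_cancel]
  · simp [RunDecomposition.runs, RunDecomposition.run, hn, Int.units_mul_self]

theorem canForce_cycleGraph_of_first {n : ℕ} (hn : 3 ≤ n) {X : Player} {goal : ℤ → Prop} {t : ℤˣ}
    {T : ℤ} (hgoal : ∀ z : ℤ, T ≤ t * z → goal z)
    (hT : T + ((n - 1) % 2 : ℕ) ≤ runWeight (n - 1, t ^ n)) :
    CanForce (SimpleGraph.cycleGraph n) X goal X (Position.empty (Fin n)) := by
  have : NeZero n := ⟨by omega⟩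
  refine .ownTurn X _ rfl 0 1 rfl ?_
  refine canForce_of_hasRuns (score_cycleGraph hn) hgoal (hasRuns_assign_empty 0 1 t) ?_ ?_ ?_
  · rw [← Multiset.cons_zero, oddRuns_cons]; simp [oddRuns]; omega
  · exact fun h => absurd h X.other_ne
  · rw [← Multiset.cons_zero, oddRuns_cons, totalWeight_cons]
    simpa [oddRuns, totalWeight] using hT

/-- For odd n the opening leaves an even run and the strategy applies at once. For even n the run is
odd, so `X` extends it first: its weight w changes sign and an edge worth 1 appears, giving 1 - w
with no odd run left. This is 0 for n ≡ 0 and 2 for n ≡ 2 (mod 4). -/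
theorem canForce_cycleGraph_of_second {n : ℕ} (hn : 3 ≤ n) {X Y : Player} (hY : Y ≠ X)
    {goal : ℤ → Prop} {t : ℤˣ} {T : ℤ} (hgoal : ∀ z : ℤ, T ≤ t * z → goal z)
    (hT : T ≤ ((n - 1) % 2 : ℕ) * (1 - 2 * runWeight (n - 1, t ^ n)) +
      runWeight (n - 1, t ^ n)) :
    CanForce (SimpleGraph.cycleGraph n) X goal Y (Position.empty (Fin n)) := by
  have : NeZero n := ⟨by omega⟩
  refine .opponentTurn Y _ hY ⟨0, rfl⟩ fun v _ s => ?_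
  have h := hasRuns_assign_empty v s t
  rw [← Multiset.cons_zero] at h
  obtain ⟨m, rfl⟩ := Nat.exists_eq_add_of_le' hn
  rw [show m + 3 - 1 = m + 1 + 1 by omega] at h hT
  rcases Nat.mod_two_eq_zero_or_one (m + 1 + 1) with hm | hm
  · refine canForce_of_hasRuns (score_cycleGraph hn) hgoal h ?_ ?_ ?_ <;>
      rw [oddRuns_cons] <;> simp [oddRuns, totalWeight, hm] at hT ⊢
    exact hT
  · obtain ⟨w, s', hw, h'⟩ := h.exists_extend
    have hsucc := runWeight_succ_of_even (m := m + 1) (by omega) (t ^ (m + 3))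
    refine .ownTurn _ _ (Player.other_eq_of_ne hY) w s' hw ?_
    refine canForce_of_hasRuns (score_cycleGraph hn) hgoal h' ?_ ?_ ?_
    · simp only [oddRuns_cons]; simp [oddRuns]; omega
    · exact fun hc => absurd (Y.other_other ▸ hc) hY
    · have hm' : (m + 1) % 2 = 0 := by omega
      simp only [oddRuns_cons, totalWeight_cons, runWeight_zero_one]
      rw [hm, hsucc] at hT
      simp [oddRuns, totalWeight, hm'] at hT ⊢
      linarith

/-! ### Winning conditions and the four residue classes -/

/-- The sign by which a player weighs the score. -/
def Player.sign : Player → ℤˣ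
  | .P => 1
  | .N => -1

theorem Player.winningScore_iff (X : Player) (z : ℤ) : X.WinningScore z ↔ 1 ≤ (X.sign : ℤ) * z := by
  cases X <;> simp [Player.WinningScore, Player.sign] <;> omega

theorem Player.not_other_winningScore_iff (X : Player) (z : ℤ) :
    ¬ X.other.WinningScore z ↔ 0 ≤ (X.sign : ℤ) * z := by
  cases X <;> simp [Player.WinningScore, Player.sign, Player.other]

theorem Player.sign_pow_even (X : Player) {n : ℕ} (hn : Even n) : X.sign ^ n = 1 := by
  cases X <;> simp [Player.sign, hn.neg_one_pow]

end SignGame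

open SignGame in
theorem mainTheorem6 (n : ℕ) (hn : 3 ≤ n) (first : SignGame.Player) :
    (n % 4 = 0 → SignGame.Draw (SimpleGraph.cycleGraph n) first) ∧
    (n % 4 = 1 → SignGame.Wins (SimpleGraph.cycleGraph n) first SignGame.Player.P) ∧
    (n % 4 = 2 → SignGame.Wins (SimpleGraph.cycleGraph n) first first.other) ∧
    (n % 4 = 3 → SignGame.Wins (SimpleGraph.cycleGraph n) first SignGame.Player.N) := by
  -- For odd n the order of play is irrelevant: the run left by the opening is even, and the player
  -- for whom it has weight 1 wins.
  have hodd : ∀ X : Player, (n - 1) % 2 = 0 → 1 ≤ runWeight (n - 1, X.sign ^ n) →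
      Wins (SimpleGraph.cycleGraph n) first X := by
    intro X hpar hw
    have hgoal := fun z => (X.winningScore_iff z).2
    by_cases hX : first = X
    · subst hX
      exact canForce_cycleGraph_of_first hn hgoal (by simpa [hpar] using hw)
    · exact canForce_cycleGraph_of_second hn hX hgoal (by simpa [hpar] using hw)
  refine ⟨fun h X => ?_, fun h => ?_, fun h => ?_, fun h => ?_⟩ <;>
    obtain ⟨q, hq⟩ : ∃ q, n = 4 * q + n % 4 := ⟨n / 4, by omega⟩ <;> rw [h] at hq
  · have hgoal := fun z => (X.not_other_winningScore_iff z).2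
    have hpar : (n - 1) % 2 = 1 := by omega
    have hw : runWeight (n - 1, X.sign ^ n) = 1 := by
      rw [X.sign_pow_even (Nat.even_iff.2 (by omega)), runWeight,
        show (n - 1 + 1) / 2 = 2 * q by omega]
      simp
    by_cases hX : first = X
    · subst hX
      exact canForce_cycleGraph_of_first hn hgoal (by simp [hpar, hw])
    · exact canForce_cycleGraph_of_second hn hX hgoal (by simp [hpar, hw])
  · refine hodd .P (by omega) ?_
    rw [runWeight, show (n - 1 + 1) / 2 = 2 * q by omega]
    simp [Player.sign]
  · have hgoal := fun z => (first.other.winningScore_iff z).2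
    have hpar : (n - 1) % 2 = 1 := by omega
    have hw : runWeight (n - 1, first.other.sign ^ n) = -1 := by
      rw [first.other.sign_pow_even (Nat.even_iff.2 (by omega)), runWeight,
        show (n - 1 + 1) / 2 = 2 * q + 1 by omega]
      simp [pow_succ]
    exact canForce_cycleGraph_of_second hn first.other_ne.symm hgoal (by simp [hpar, hw])
  · refine hodd .N (by omega) ?_
    have hn' : Odd n := Nat.odd_iff.2 (by omega)
    rw [runWeight, show (n - 1 + 1) / 2 = 2 * q + 1 by omega]
    simp [Player.sign, pow_succ, hn'.neg_one_pow]
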